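/- All graphs are finite and simple. For a graph $G$ let $\phi^G$ be the characteristic polynomial of its adjacency matrix, and for a vertex $i$ of $G$ let $\alpha_i^G=\phi^G/\phi^{G\setminus i}$, a rational function, where $G\setminus i$ is obtained from $G$ by deleting the vertex $i$. A graph is integral if all eigenvalues of its adjacency matrix are integers. (a) Let $T_1$ and $T_2$ be trees with roots $1$ and $2$ respectively, and let $T$ be their rooted product over the path $P_2$, that is, the tree obtained from the disjoint union of $T_1$ and $T_2$ by adding the edge $\{1,2\}$. Assume that $\alpha_1^{T_1}=\alpha_2^{T_2}$ and that the root $1$ has eccentricity larger than $1$ in $T_1$ (that is, $T_1$ has diameter larger than $1$ and is not a star rooted at its centre). Then $T$ is not integral. (b) In particular, there is no balanced integral tree of odd diameter greater than three. Here the centre of a tree is the vertex (if the diameter is even) or the edge (if the diameter is odd) in the middle of any path whose length is the diameter, and a tree is balanced if all vertices at the same distance from its centre have the same degree (the distance from a vertex to an edge is its distance to the nearer end of the edge). -/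

import Mathlib

open Polynomial

namespace SimpleGraph

/-- The rooted product of a graph `H` with a family of rooted graphs `(G i, r i)`, indexed by the
vertices of `H`: the root of `G i` is identified with the vertex `i` of `H`. So its vertex set is
the disjoint union of the vertex sets of the `G i`; two vertices are adjacent if they are adjacent
in the same `G i`, or if they are the roots of `G i` and `G j` with `i` and `j` adjacent in `H`. -/
def rootedProduct {ι : Type*} {V : ι → Type*} (H : SimpleGraph ι)
    (G : ∀ i, SimpleGraph (V i)) (r : ∀ i, V i) : SimpleGraph (Σ i, V i) where
  Adj a b := (∃ (i : ι) (u v : V i), (G i).Adj u v ∧ a = ⟨i, u⟩ ∧ b = ⟨i, v⟩) ∨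
    (∃ i j : ι, H.Adj i j ∧ a = ⟨i, r i⟩ ∧ b = ⟨j, r j⟩)
  symm := ⟨by
    rintro a b (⟨i, u, v, h, ha, hb⟩ | ⟨i, j, h, ha, hb⟩)
    · exact Or.inl ⟨i, v, u, h.symm, hb, ha⟩
    · exact Or.inr ⟨j, i, h.symm, hb, ha⟩⟩
  loopless := ⟨by
    rintro a (⟨i, u, v, h, rfl, hb⟩ | ⟨i, j, h, rfl, hb⟩)
    · obtain rfl := eq_of_heq (Sigma.mk.inj hb).2
      exact h.ne rfl
    · exact h.ne (Sigma.mk.inj hb).1⟩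

open scoped Classical in
/-- The characteristic polynomial of (the adjacency matrix of) a finite graph. -/
noncomputable def graphCharpoly {V : Type*} [Fintype V] (G : SimpleGraph V) : ℝ[X] :=
  (G.adjMatrix ℝ).charpoly

open scoped Classical in
/-- The rational function obtained by dividing the characteristic polynomial of `G` by that of the
graph obtained from `G` by deleting the vertex `i`. -/
noncomputable def alpha {V : Type*} [Fintype V] (G : SimpleGraph V) (i : V) : RatFunc ℝ :=
  algebraMap ℝ[X] (RatFunc ℝ) G.graphCharpoly /
    algebraMap ℝ[X] (RatFunc ℝ) (G.induce ({i}ᶜ : Set V)).graphCharpoly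

open scoped Classical in
/-- A finite graph is integral if every eigenvalue of its adjacency matrix is an integer (the
matrix is real symmetric, so all of its eigenvalues are real). -/
def IsIntegralGraph {V : Type*} [Fintype V] (G : SimpleGraph V) : Prop :=
  ∀ θ : ℝ, Module.End.HasEigenvalue (Matrix.toLin' (G.adjMatrix ℝ)) θ → ∃ m : ℤ, θ = m

/-- A diametral path: a shortest path between two vertices whose distance is the diameter. -/
def Walk.IsDiametral {V : Type*} {G : SimpleGraph V} {u v : V} (p : G.Walk u v) : Prop :=
  p.length = G.dist u v ∧ G.dist u v = G.diam

/-- The distance from the vertex `x` to the middle of the walk `p`. The middle is a vertex if the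
length of `p` is even, and an edge if it is odd; the distance to an edge is the distance to the
nearer one of its two ends. -/
noncomputable def Walk.distToMiddle {V : Type*} {G : SimpleGraph V} {u v : V} (p : G.Walk u v)
    (x : V) : ℕ :=
  min (G.dist x (p.getVert (p.length / 2))) (G.dist x (p.getVert ((p.length + 1) / 2)))

open scoped Classical in
/-- A finite tree is balanced if vertices at the same distance from its centre have the same
degree; the centre is the middle vertex or middle edge of a diametral path (in a tree, all
diametral paths have the same middle). -/
def IsBalancedTree {V : Type*} [Fintype V] (G : SimpleGraph V) : Prop :=
  G.IsTree ∧ ∃ (u v : V) (p : G.Walk u v), p.IsDiametral ∧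
    ∀ x y : V, p.distToMiddle x = p.distToMiddle y → G.degree x = G.degree y

end SimpleGraph

/-! Let `A` be real symmetric of order n, φ its characteristic polynomial and ψ the principal minor
of X - A without index i. Write φ = gP and ψ = gQ with P, Q coprime. Then A ± e eᵀ, with e the i-th
basis vector, has characteristic polynomial g(P ∓ Q). Differentiating (X - A) adj(X - A) = φ·1 shows
that the squares in column i of the adjugate sum to φ'ψ - φψ' = g²(P'Q - PQ'). So g divides that
column, and P'Q - PQ' ≥ Q². Hence the roots of P + Q and P - Q are simple and interlace: each root
of P + Q has its own root of P - Q above it. If all were integers, these gaps would add up to at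
least deg P; but the two sums of roots differ by exactly 2, so deg P ≤ 2. If some index j is at
distance two from i, the (j, i) entry of the adjugate is nonzero of degree at most n - 3 and
divisible by g, which forces deg P ≥ 3. So P(θ) = εQ(θ) for some ε = ±1 and some non-integer θ
(`exists_eigenvector_add_single`).

A loop of weight ε at a root simulates the edge to the other root. In (a), equality of the two
quotients makes θ an eigenvalue of both looped trees, and suitably scaled eigenvectors glue along
the edge. Part (b) does not pass through (a): each half of a balanced tree collapses to a weighted
path, the matrix lemma is applied to that path, and its eigenvector is spread over the levels of
both halves. -/

namespace Polynomial

/-! ### Real-rooted polynomials: interlacing and divisibility -/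

/-- The quotient of two real polynomials is antitone on an interval without roots of the
denominator if the Wronskian is nonnegative there. -/
theorem antitoneOn_eval_div {f g : ℝ[X]} {s : Set ℝ} (hs : Convex ℝ s)
    (hf : ∀ x ∈ s, f.eval x ≠ 0)
    (hW : ∀ x, 0 ≤ f.derivative.eval x * g.eval x - f.eval x * g.derivative.eval x) :
    AntitoneOn (fun x => g.eval x / f.eval x) s := by
  have hd : ∀ x ∈ s, HasDerivAt (fun x => g.eval x / f.eval x)
      ((g.derivative.eval x * f.eval x - g.eval x * f.derivative.eval x) / f.eval x ^ 2) x :=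
    fun x hx => (g.hasDerivAt x).div (f.hasDerivAt x) (hf x hx)
  refine antitoneOn_of_deriv_nonpos hs (fun x hx => (hd x hx).continuousAt.continuousWithinAt)
    (fun x hx => (hd x (interior_subset hx)).differentiableAt.differentiableWithinAt)
    fun x hx => ?_
  rw [(hd x (interior_subset hx)).deriv]
  exact div_nonpos_of_nonpos_of_nonneg (by linarith [hW x]) (sq_nonneg _)

theorem nodup_roots_of_wronskian {f g : ℝ[X]} (hf : f ≠ 0)
    (hW : ∀ x, f.eval x = 0 →
      f.derivative.eval x * g.eval x - f.eval x * g.derivative.eval x ≠ 0) : f.roots.Nodup := by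
  classical
  rw [Multiset.nodup_iff_count_le_one]
  intro x
  by_contra! h
  rw [count_roots, one_lt_rootMultiplicity_iff_isRoot hf] at h
  have h1 : f.eval x = 0 := h.1
  have h2 : f.derivative.eval x = 0 := h.2
  exact hW x h1 (by rw [h1, h2]; ring)

theorem eq_zero_of_eval_eq_zero_Icc {g : ℝ[X]} {a b : ℝ} (hab : a < b)
    (h : ∀ x ∈ Set.Icc a b, g.eval x = 0) : g = 0 :=
  eq_zero_of_infinite_isRoot g ((Set.Icc_infinite hab).mono h)

/-- If the Wronskian of two monic real-rooted polynomials `f`, `g` of the same degree is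
nonnegative and they have no common roots, their roots interlace; this gives a bound for the
difference of the sums of the roots, provided that these are integers. -/
theorem natDegree_le_sum_roots_sub {f g : ℝ[X]} (hf : f.Monic) (hg : g.Monic)
    (hd : f.natDegree = g.natDegree)
    (hW : ∀ x, 0 ≤ f.derivative.eval x * g.eval x - f.eval x * g.derivative.eval x)
    (hWf : ∀ x, f.eval x = 0 →
      f.derivative.eval x * g.eval x - f.eval x * g.derivative.eval x ≠ 0)
    (hWg : ∀ x, g.eval x = 0 →
      f.derivative.eval x * g.eval x - f.eval x * g.derivative.eval x ≠ 0)
    (hsf : f.Splits) (hsg : g.Splits)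
    (hif : ∀ x, f.eval x = 0 → ∃ k : ℤ, x = k) (hig : ∀ x, g.eval x = 0 → ∃ k : ℤ, x = k) :
    (f.natDegree : ℝ) ≤ f.roots.sum - g.roots.sum := by
  classical
  have hf0 := hf.ne_zero
  have hg0 := hg.ne_zero
  have hnf : f.roots.Nodup := nodup_roots_of_wronskian hf0 hWf
  have hng : g.roots.Nodup := nodup_roots_of_wronskian (g := f) hg0 fun x hx h =>
    hWg x hx (by linarith)
  have hne : ∀ x, g.eval x = 0 → f.eval x ≠ 0 := fun x h1 h2 => hWg x h1 (by rw [h1, h2]; ring)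
  have hex : ∀ x, g.eval x = 0 → ∃ y, x < y ∧ f.eval y = 0 := by
    intro x hx
    by_contra! h
    have hno : ∀ y ∈ Set.Ici x, f.eval y ≠ 0 := by
      intro y hy
      rcases eq_or_lt_of_le (Set.mem_Ici.1 hy) with rfl | hlt
      · exact hne _ hx
      · exact h y hlt
    -- With no root of `f` to the right, g/f would decrease from 0 at `x` and yet tend to 1.
    have hanti := antitoneOn_eval_div (g := g) (convex_Ici x) hno hW
    have hlim := div_tendsto_atTop_leadingCoeff_div_of_degree_eq g f
      (by rw [degree_eq_natDegree hf0, degree_eq_natDegree hg0, hd])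
    rw [hf.leadingCoeff, hg.leadingCoeff, div_one] at hlim
    have : (1 : ℝ) ≤ 0 := by
      refine le_of_tendsto hlim ?_
      filter_upwards [Filter.eventually_ge_atTop x] with y hy
      have := hanti Set.self_mem_Ici (Set.mem_Ici.2 hy) hy
      simpa [hx] using this
    linarith
  -- `t x` will be the least root of `f` above the root `x` of `g`; the value elsewhere is
  -- irrelevant.
  have hmin : ∀ x, ∃ y, g.eval x = 0 → (x < y ∧ f.eval y = 0 ∧
      ∀ z, x < z → f.eval z = 0 → y ≤ z) := by
    intro x
    by_cases hx : g.eval x = 0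
    · obtain ⟨y, hy, hfy⟩ := hex x hx
      have hmem : y ∈ f.roots.toFinset.filter (x < ·) := by simp [hf0, hfy, hy]
      obtain ⟨m, hm, hm'⟩ := Finset.exists_min_image _ id ⟨y, hmem⟩
      simp only [Finset.mem_filter, Multiset.mem_toFinset, mem_roots hf0, IsRoot.def] at hm hm'
      exact ⟨m, fun _ => ⟨hm.2, hm.1, fun z h1 h2 => hm' z ⟨h2, h1⟩⟩⟩
    · exact ⟨0, fun h => absurd h hx⟩
  choose t ht using hmin
  -- A shared value leaves no root of `f` in [x, y], so g/f is antitone there and zero at both ends,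
  -- hence identically zero.
  have hmono : ∀ x y, g.eval x = 0 → g.eval y = 0 → x < y → t x ≠ t y := by
    intro x y hx hy hxy hxt
    have hno : ∀ z ∈ Set.Icc x y, f.eval z ≠ 0 := by
      intro z hz hfz
      rcases eq_or_lt_of_le hz.1 with rfl | hlt
      · exact hne _ hx hfz
      · have h1 := (ht x hx).2.2 z hlt hfz
        have h2 := (ht y hy).1
        have h3 := hz.2
        linarith
    have hanti := antitoneOn_eval_div (g := g) (convex_Icc x y) hno hW
    refine hg0 (eq_zero_of_eval_eq_zero_Icc hxy fun z hz => ?_)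
    have h1 := hanti (Set.left_mem_Icc.2 hxy.le) hz hz.1
    have h2 := hanti hz (Set.right_mem_Icc.2 hxy.le) hz.2
    simp only [hx, hy, zero_div] at h1 h2
    have h3 := le_antisymm h1 h2
    exact (div_eq_zero_iff.1 h3).resolve_right (hno z hz)
  have hinj : Set.InjOn t g.roots.toFinset := by
    intro x hx y hy hxy
    simp only [Finset.mem_coe, Multiset.mem_toFinset, mem_roots hg0, IsRoot.def] at hx hy
    rcases lt_trichotomy x y with h | h | h
    · exact absurd hxy (hmono x y hx hy h)
    · exact h
    · exact absurd hxy.symm (hmono y x hy hx h)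
  have hcf : f.roots.toFinset.card = f.natDegree := by
    rw [Multiset.toFinset_card_of_nodup hnf, hsf.natDegree_eq_card_roots]
  have hcg : g.roots.toFinset.card = f.natDegree := by
    rw [Multiset.toFinset_card_of_nodup hng, hd, hsg.natDegree_eq_card_roots]
  have himg : g.roots.toFinset.image t = f.roots.toFinset := by
    refine Finset.eq_of_subset_of_card_le ?_ (by rw [Finset.card_image_of_injOn hinj, hcf, hcg])
    intro y hy
    obtain ⟨x, hx, rfl⟩ := Finset.mem_image.1 hy
    simp only [Multiset.mem_toFinset, mem_roots hg0, mem_roots hf0, IsRoot.def] at hx ⊢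
    exact (ht x hx).2.1
  have hsum : ∀ p : ℝ[X], p.roots.Nodup → p.roots.sum = ∑ x ∈ p.roots.toFinset, x := by
    intro p hp
    rw [Finset.sum_multiset_count]
    refine Finset.sum_congr rfl fun x hx => ?_
    rw [Multiset.count_eq_one_of_mem hp (Multiset.mem_toFinset.1 hx), one_smul]
  rw [hsum f hnf, hsum g hng, ← himg, Finset.sum_image hinj, ← Finset.sum_sub_distrib, ← hcg,
    ← nsmul_one]
  refine Finset.card_nsmul_le_sum _ _ _ fun x hx => ?_
  simp only [Multiset.mem_toFinset, mem_roots hg0, IsRoot.def] at hx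
  obtain ⟨h1, h2, -⟩ := ht x hx
  obtain ⟨k, hk⟩ := hig x hx
  obtain ⟨l, hl⟩ := hif _ h2
  rw [hk] at h1 ⊢
  rw [hk] at hl
  rw [hl] at h1 ⊢
  have : k + 1 ≤ l := by exact_mod_cast h1
  have : (k : ℝ) + 1 ≤ l := by exact_mod_cast this
  linarith

/-- The Wronskian of P - Q and P + Q is twice that of P and Q, so the interlacing bound applies. The
second coefficients differ by 2, which is therefore the difference of the sums of the roots. -/
theorem natDegree_le_two_of_integer_roots {P Q : ℝ[X]} (hP : P.Monic) (hQ : Q.Monic)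
    (hd : P.natDegree = Q.natDegree + 1) (hc : ∀ x, Q.eval x = 0 → P.eval x ≠ 0)
    (hW : ∀ x, Q.eval x ^ 2 ≤ P.derivative.eval x * Q.eval x - P.eval x * Q.derivative.eval x)
    (hs : (P - Q).Splits) (hs' : (P + Q).Splits)
    (hi : ∀ x, P.eval x = Q.eval x → ∃ k : ℤ, x = k)
    (hi' : ∀ x, P.eval x = -Q.eval x → ∃ k : ℤ, x = k) : P.natDegree ≤ 2 := by
  have hlt : Q.degree < P.degree := by
    rw [degree_eq_natDegree hP.ne_zero, degree_eq_natDegree hQ.ne_zero, hd]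
    exact_mod_cast Nat.lt_succ_self _
  have hf : (P - Q).Monic := hP.sub_of_left hlt
  have hg : (P + Q).Monic := hP.add_of_left hlt
  have hnf : (P - Q).natDegree = P.natDegree :=
    natDegree_eq_of_degree_eq (degree_sub_eq_left_of_degree_lt hlt)
  have hng : (P + Q).natDegree = P.natDegree :=
    natDegree_eq_of_degree_eq (degree_add_eq_left_of_degree_lt hlt)
  have hpos : ∀ x, Q.eval x ≠ 0 →
      0 < P.derivative.eval x * Q.eval x - P.eval x * Q.derivative.eval x :=
    fun x hx => lt_of_lt_of_le (by positivity) (hW x)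
  have key := natDegree_le_sum_roots_sub hf hg (hnf.trans hng.symm)
    (fun x => by
      simp only [derivative_sub, derivative_add, eval_sub, eval_add]
      nlinarith [hW x, sq_nonneg (Q.eval x)])
    (fun x hx => by
      simp only [derivative_sub, derivative_add, eval_sub, eval_add] at hx ⊢
      have := hpos x fun h => hc x h (by rw [h] at hx; linarith)
      exact ne_of_gt (by nlinarith))
    (fun x hx => by
      simp only [derivative_sub, derivative_add, eval_sub, eval_add] at hx ⊢
      have := hpos x fun h => hc x h (by rw [h] at hx; linarith)
      exact ne_of_gt (by nlinarith))
    hs hs' (fun x hx => hi x (by rw [eval_sub] at hx; linarith))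
    (fun x hx => hi' x (by rw [eval_add] at hx; linarith))
  have h1 := hs.nextCoeff_eq_neg_sum_roots_of_monic hf
  have h2 := hs'.nextCoeff_eq_neg_sum_roots_of_monic hg
  rw [nextCoeff_of_natDegree_pos (by omega), hnf, hd, Nat.add_sub_cancel, coeff_sub,
    hQ.coeff_natDegree] at h1
  rw [nextCoeff_of_natDegree_pos (by omega), hng, hd, Nat.add_sub_cancel, coeff_add,
    hQ.coeff_natDegree] at h2
  rw [hnf] at key
  have : (P.natDegree : ℝ) ≤ 2 := by linarith
  exact_mod_cast this

/-- The roots of `g` can be peeled off one by one: at a root the bound forces `p` to vanish, and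
cancelling (x - r)² preserves the bound, at r itself by continuity. -/
theorem Splits.dvd_of_sq_eval_le {g : ℝ[X]} (hg : g.Splits) (hg0 : g ≠ 0) {p S : ℝ[X]}
    (h : ∀ x, p.eval x ^ 2 ≤ g.eval x ^ 2 * S.eval x) : g ∣ p := by
  induction hn : g.natDegree generalizing g p with
  | zero =>
    exact (isUnit_iff_degree_eq_zero.2 (by rw [degree_eq_natDegree hg0, hn]; rfl)).dvd
  | succ n ih =>
    obtain ⟨r, hr⟩ := hg.exists_eval_eq_zero (by
      rw [degree_eq_natDegree hg0, hn]; exact_mod_cast Nat.succ_ne_zero n)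
    have hp : p.eval r = 0 := by
      have := h r
      rw [hr] at this
      exact pow_eq_zero_iff two_ne_zero |>.1 (le_antisymm (by simpa using this) (sq_nonneg _))
    obtain ⟨q, rfl⟩ := dvd_iff_isRoot.2 hp
    obtain ⟨k, rfl⟩ := dvd_iff_isRoot.2 hr
    have hk0 : k ≠ 0 := right_ne_zero_of_mul hg0
    refine mul_dvd_mul_left _ (ih ((splits_X_sub_C_mul_iff).1 hg) hk0 (fun x => ?_) ?_)
    · have hlim : Filter.Tendsto (fun y => (k ^ 2 * S - q ^ 2).eval y) (nhdsWithin x {r}ᶜ)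
          (nhds ((k ^ 2 * S - q ^ 2).eval x)) :=
        ((k ^ 2 * S - q ^ 2).continuous.tendsto x).mono_left nhdsWithin_le_nhds
      have hbot : (nhdsWithin x ({r}ᶜ : Set ℝ)).NeBot :=
        mem_closure_iff_nhdsWithin_neBot.1 (dense_compl_singleton r x)
      have h0 : 0 ≤ (k ^ 2 * S - q ^ 2).eval x := by
        refine ge_of_tendsto hlim ?_
        filter_upwards [self_mem_nhdsWithin] with y hy
        have hy' : 0 < (y - r) ^ 2 := by
          have : y - r ≠ 0 := sub_ne_zero.2 hy
          positivity
        have := h y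
        simp only [eval_mul, eval_sub, eval_X, eval_C, eval_pow] at this ⊢
        by_contra! hneg
        nlinarith
      simp only [eval_mul, eval_sub, eval_pow] at h0
      linarith
    · rw [natDegree_mul (X_sub_C_ne_zero r) hk0, natDegree_X_sub_C] at hn
      omega

end Polynomial

/-! ### The adjugate of the characteristic matrix -/

namespace Matrix

variable {n : Type*} [Fintype n] [DecidableEq n]

theorem derivative_charmatrix (A : Matrix n n ℝ) (k l : n) :
    derivative (A.charmatrix k l) = (1 : Matrix n n ℝ[X]) k l := by
  by_cases h : k = l
  · subst h; simp
  · simp [h, charmatrix_apply_ne]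

/-- With M = X - A and N its adjugate, M' = 1, so differentiating MN = φ·1 gives N + MN' = φ'·1;
then multiply by N on the left. -/
theorem adjugate_charmatrix_sq (A : Matrix n n ℝ) :
    A.charmatrix.adjugate * A.charmatrix.adjugate
      + A.charpoly • A.charmatrix.adjugate.map derivative
      = derivative A.charpoly • A.charmatrix.adjugate := by
  set N := A.charmatrix.adjugate with hN
  have h1 : A.charmatrix * N = A.charpoly • 1 := mul_adjugate _
  have h2 : N * A.charmatrix = A.charpoly • 1 := adjugate_mul _
  have h3 : N + A.charmatrix * N.map derivative = derivative A.charpoly • 1 := by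
    ext1 k j
    have := congrArg derivative (congrFun (congrFun h1 k) j)
    simp only [mul_apply, derivative_sum, derivative_mul, derivative_charmatrix,
      Finset.sum_add_distrib, smul_apply, smul_eq_mul] at this
    have h4 : ∑ l, (1 : Matrix n n ℝ[X]) k l * N l j = N k j := by
      rw [← mul_apply, Matrix.one_mul]
    have h5 : derivative ((1 : Matrix n n ℝ[X]) k j) = 0 := by
      by_cases h : k = j <;> simp [one_apply, h]
    rw [h4, h5] at this
    simpa [mul_apply] using this
  have h4 := congrArg (N * ·) h3
  simp only [Matrix.mul_add, ← Matrix.mul_assoc, h2] at h4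
  simpa using h4

/-- The diagonal entry of the preceding identity, where symmetry turns N² into a sum of squares. All
positivity used later comes from here. -/
theorem sum_sq_adjugate_charmatrix {A : Matrix n n ℝ} (hA : A.IsSymm) (i : n) :
    ∑ j, A.charmatrix.adjugate j i ^ 2
      = derivative A.charpoly * A.charmatrix.adjugate i i
        - A.charpoly * derivative (A.charmatrix.adjugate i i) := by
  have hs : ∀ j, A.charmatrix.adjugate i j = A.charmatrix.adjugate j i := by
    intro j
    have h : A.charmatrix.adjugateᵀ = A.charmatrix.adjugate := by
      rw [adjugate_transpose, ← charmatrix_transpose, hA.eq]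
    exact congrFun (congrFun h j) i
  have h := congrFun (congrFun (adjugate_charmatrix_sq A) i) i
  simp only [add_apply, mul_apply, smul_apply, map_apply, smul_eq_mul, hs] at h
  simp only [sq]
  linear_combination h

theorem adjugate_apply_self_eq_det {R : Type*} [CommRing R] (M : Matrix n n R) (i : n) :
    M.adjugate i i = (M.toSquareBlockProp (· ≠ i)).det := by
  rw [adjugate_apply, twoBlockTriangular_det _ (· ≠ i)]
  · have h1 : (toSquareBlockProp (M.updateRow i (Pi.single i 1)) fun k => ¬ (k ≠ i)).det = 1 := by
      have : toSquareBlockProp (M.updateRow i (Pi.single i 1)) (fun k => ¬ (k ≠ i)) = 1 := by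
        ext ⟨k, hk⟩ ⟨l, hl⟩
        obtain rfl := not_not.1 hk
        obtain rfl := not_not.1 hl
        simp [toSquareBlockProp_def]
      rw [this, det_one]
    rw [h1, mul_one]
    congr 1
    ext ⟨k, hk⟩ ⟨l, hl⟩
    simp [toSquareBlockProp_def, updateRow_ne hk]
  · intro k hk l hl
    obtain rfl := not_not.1 hk
    simp [hl]

theorem toSquareBlockProp_charmatrix (A : Matrix n n ℝ) (p : n → Prop) [DecidablePred p] :
    A.charmatrix.toSquareBlockProp p = (A.toSquareBlockProp p).charmatrix := by
  ext1 ⟨k, hk⟩ ⟨l, hl⟩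
  by_cases h : k = l
  · subst h; simp [toSquareBlockProp_def]
  · simp [toSquareBlockProp_def, charmatrix_apply_ne, h]

theorem adjugate_charmatrix_apply_self (A : Matrix n n ℝ) (i : n) :
    A.charmatrix.adjugate i i = (A.toSquareBlockProp (· ≠ i)).charpoly := by
  rw [adjugate_apply_self_eq_det, toSquareBlockProp_charmatrix, charpoly]

theorem monic_adjugate_charmatrix (A : Matrix n n ℝ) (i : n) :
    (A.charmatrix.adjugate i i).Monic := by
  rw [adjugate_charmatrix_apply_self]; exact charpoly_monic _

theorem natDegree_adjugate_charmatrix (A : Matrix n n ℝ) (i : n) :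
    (A.charmatrix.adjugate i i).natDegree + 1 = Fintype.card n := by
  rw [adjugate_charmatrix_apply_self, charpoly_natDegree_eq_dim]
  have := Fintype.card_subtype_compl (fun k => k = i)
  have h2 := Fintype.card_pos_iff.2 ⟨i⟩
  rw [Fintype.card_subtype_eq] at this
  change Fintype.card {k // ¬ k = i} + 1 = _
  omega

/-- The determinant is linear in row i, and the correction term is the cofactor at (i, i). -/
theorem charpoly_add_single (A : Matrix n n ℝ) (i : n) (c : ℝ) :
    (A + single i i c).charpoly = A.charpoly - C c * A.charmatrix.adjugate i i := by
  have h : (A + single i i c).charmatrix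
      = A.charmatrix.updateRow i (A.charmatrix i + (-C c) • Pi.single i 1) := by
    ext1 k l
    by_cases hk : k = i
    · subst hk
      by_cases hl : l = k
      · subst hl
        simp
        ring
      · simp [hl, Ne.symm hl]
    · simp [charmatrix_apply, hk, Ne.symm hk]
  rw [charpoly, h, det_updateRow_add, det_updateRow_smul, updateRow_eq_self, ← adjugate_apply,
    charpoly]
  ring

theorem X_mul_adjugate_charmatrix (A : Matrix n n ℝ) (i k : n) :
    X * A.charmatrix.adjugate k i
      = ∑ l, C (A k l) * A.charmatrix.adjugate l i + if k = i then A.charpoly else 0 := by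
  have h := congrFun (congrFun (mul_adjugate A.charmatrix) k) i
  have h1 : ∀ l, A.charmatrix k l = (if k = l then X else 0) - C (A k l) := fun l => by
    simp [charmatrix_apply, diagonal_apply]
  simp only [mul_apply, h1, sub_mul, Finset.sum_sub_distrib, ite_mul, zero_mul,
    Finset.sum_ite_eq, Finset.mem_univ, if_true, smul_apply, one_apply, smul_eq_mul, mul_ite,
    mul_one, mul_zero] at h
  rw [charpoly]
  linear_combination h

theorem coeff_adjugate_charmatrix_of_ne (A : Matrix n n ℝ) {i k : n} (hk : k ≠ i) (d : ℕ) :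
    (A.charmatrix.adjugate k i).coeff d
      = ∑ l, A k l * (A.charmatrix.adjugate l i).coeff (d + 1) := by
  have := congrArg (coeff · (d + 1)) (X_mul_adjugate_charmatrix A i k)
  simpa [hk, coeff_X_mul] using this

theorem coeff_adjugate_charmatrix_eq_zero (A : Matrix n n ℝ) {i k : n} (hk : k ≠ i) {d : ℕ}
    (hd : Fintype.card n ≤ d + 1) : (A.charmatrix.adjugate k i).coeff d = 0 := by
  obtain ⟨N, hN⟩ : ∃ N, ∀ l, (A.charmatrix.adjugate l i).natDegree < N :=
    ⟨_, fun l => Nat.lt_succ_of_le (Finset.le_sup (f := fun l =>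
      (A.charmatrix.adjugate l i).natDegree) (Finset.mem_univ l))⟩
  -- Descending induction on the degree, starting at `N`, above all the degrees in the column.
  suffices ∀ t d, Fintype.card n ≤ d + 1 → N ≤ d + t → ∀ k ≠ i,
      (A.charmatrix.adjugate k i).coeff d = 0 from this N d hd (by omega) k hk
  intro t
  induction t with
  | zero => exact fun d _ h k _ => coeff_eq_zero_of_natDegree_lt ((hN k).trans_le h)
  | succ t ih =>
    intro d hd h k hk
    rw [coeff_adjugate_charmatrix_of_ne A hk]
    refine Finset.sum_eq_zero fun l _ => ?_
    by_cases hl : l = i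
    · subst hl
      rw [coeff_eq_zero_of_natDegree_lt, mul_zero]
      have := natDegree_adjugate_charmatrix A l
      omega
    · rw [ih (d + 1) (by omega) (by omega) l hl, mul_zero]

theorem coeff_adjugate_charmatrix_card_sub_two (A : Matrix n n ℝ) {i k : n} (hk : k ≠ i) {d : ℕ}
    (hd : Fintype.card n = d + 2) : (A.charmatrix.adjugate k i).coeff d = A k i := by
  rw [coeff_adjugate_charmatrix_of_ne A hk, Finset.sum_eq_single i]
  · have h1 := natDegree_adjugate_charmatrix A i
    have h2 := (monic_adjugate_charmatrix A i).coeff_natDegree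
    rw [show (A.charmatrix.adjugate i i).natDegree = d + 1 by omega] at h2
    rw [h2, mul_one]
  · intro l _ hl
    rw [coeff_adjugate_charmatrix_eq_zero A hl (by omega), mul_zero]
  · simp

/-- Off-diagonal entries of the adjugate in positions at distance two have degree `n - 3`. -/
theorem natDegree_adjugate_charmatrix_of_sq_ne_zero (A : Matrix n n ℝ) {i j : n} (hj : j ≠ i)
    (h1 : A j i = 0) (h2 : (A * A) j i ≠ 0) :
    A.charmatrix.adjugate j i ≠ 0 ∧
      (A.charmatrix.adjugate j i).natDegree + 3 ≤ Fintype.card n := by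
  obtain ⟨l, -, hl⟩ : ∃ l ∈ Finset.univ, A j l * A l i ≠ 0 :=
    Finset.exists_ne_zero_of_sum_ne_zero (by rwa [← mul_apply])
  have hli : l ≠ i := by rintro rfl; simp [h1] at hl
  have hlj : l ≠ j := by rintro rfl; simp [h1] at hl
  have hc : 3 ≤ Fintype.card n := by
    rw [← Finset.card_eq_three.2 ⟨i, j, l, hj.symm, hli.symm, hlj.symm, rfl⟩]
    exact Finset.card_le_univ _
  obtain ⟨d, hd⟩ := Nat.exists_eq_add_of_le' hc
  -- The coefficient of degree n - 3 counts walks of length two from j to i.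
  have hco : (A.charmatrix.adjugate j i).coeff d = (A * A) j i := by
    rw [coeff_adjugate_charmatrix_of_ne A hj, mul_apply]
    refine Finset.sum_congr rfl fun k _ => ?_
    by_cases hk : k = i
    · subst hk; simp [h1]
    · rw [coeff_adjugate_charmatrix_card_sub_two A hk (by omega)]
  refine ⟨fun h => h2 (by rw [← hco, h, coeff_zero]), ?_⟩
  have : (A.charmatrix.adjugate j i).natDegree ≤ d := by
    rw [natDegree_le_iff_coeff_eq_zero]
    intro N hN
    obtain ⟨e, rfl⟩ : ∃ e, N = d + 1 + e := ⟨N - (d + 1), by omega⟩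
    rcases Nat.eq_zero_or_pos e with rfl | he
    · rw [Nat.add_zero, coeff_adjugate_charmatrix_card_sub_two A hj (by omega), h1]
    · exact coeff_adjugate_charmatrix_eq_zero A hj (by omega)
  omega

end Matrix

/-! ### A non-integer eigenvalue after adding a loop of weight ±1 -/

theorem Polynomial.Monic.exists_eq_mul_isCoprime {p q : ℝ[X]} (hp : p.Monic) (hq : q.Monic) :
    ∃ g P Q : ℝ[X], g.Monic ∧ P.Monic ∧ Q.Monic ∧ p = g * P ∧ q = g * Q ∧ IsCoprime P Q := by
  classical
  obtain ⟨a, ha⟩ := EuclideanDomain.gcd_dvd_left p q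
  obtain ⟨b, hb⟩ := EuclideanDomain.gcd_dvd_right p q
  have hab := EuclideanDomain.gcd_eq_gcd_ab p q
  set g := EuclideanDomain.gcd p q with hg
  have hg0 : g ≠ 0 := fun h => hp.ne_zero (by rw [ha, h, zero_mul])
  have hc := leadingCoeff_ne_zero.2 hg0
  have hgm : (g * C g.leadingCoeff⁻¹).Monic := monic_mul_leadingCoeff_inv hg0
  have hcc : C g.leadingCoeff⁻¹ * C g.leadingCoeff = (1 : ℝ[X]) := by
    rw [← C_mul, inv_mul_cancel₀ hc, C_1]
  have hpe : p = g * C g.leadingCoeff⁻¹ * (C g.leadingCoeff * a) := by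
    linear_combination ha - g * a * hcc
  have hqe : q = g * C g.leadingCoeff⁻¹ * (C g.leadingCoeff * b) := by
    linear_combination hb - g * b * hcc
  refine ⟨_, _, _, hgm, hgm.of_mul_monic_left (hpe ▸ hp), hgm.of_mul_monic_left (hqe ▸ hq),
    hpe, hqe, ⟨C g.leadingCoeff⁻¹ * EuclideanDomain.gcdA p q,
      C g.leadingCoeff⁻¹ * EuclideanDomain.gcdB p q, ?_⟩⟩
  apply mul_left_cancel₀ hg0
  linear_combination (-1 : ℝ[X]) * hab - EuclideanDomain.gcdA p q * ha
    - EuclideanDomain.gcdB p q * hb + (g * a * EuclideanDomain.gcdA p q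
    + g * b * EuclideanDomain.gcdB p q) * hcc

namespace Matrix

variable {n : Type*} [Fintype n] [DecidableEq n]

theorem IsSymm.splits_charpoly_add_single {A : Matrix n n ℝ} (hA : A.IsSymm) (i : n) (c : ℝ) :
    (A + single i i c).charpoly.Splits := by
  apply IsHermitian.splits_charpoly
  rw [IsHermitian, conjTranspose_eq_transpose_of_trivial, transpose_add, hA.eq,
    transpose_single]

/-- If `A` is a real symmetric matrix and the position `(j, i)` is at distance two, then one of
the matrices `A ± e eᵀ`, where `e` is the `i`-th standard basis vector, has an eigenvalue which is
not an integer, with an eigenvector whose entry at `i` does not vanish. Moreover this eigenvalue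
is determined by the quotient of the characteristic polynomials of `A` and its principal minor. -/
theorem IsSymm.exists_eigenvector_add_single {A : Matrix n n ℝ} (hA : A.IsSymm) {i j : n}
    (hj : j ≠ i) (h1 : A j i = 0) (h2 : (A * A) j i ≠ 0) :
    ∃ (ε θ : ℝ) (w : n → ℝ), ε * ε = 1 ∧ (¬ ∃ k : ℤ, θ = k) ∧ w i ≠ 0 ∧
      A *ᵥ w + Pi.single i (ε * w i) = θ • w ∧
      ∀ F G : ℝ[X], A.charpoly * G = F * A.charmatrix.adjugate i i →
        F.eval θ = ε * G.eval θ := by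
  obtain ⟨g, P, Q, hg, hP, hQ, hφ, hψ, a, b, hab⟩ :=
    (charpoly_monic A).exists_eq_mul_isCoprime (monic_adjugate_charmatrix A i)
  have hsg : g.Splits := by
    have hs := hA.splits_charpoly_add_single i 0
    rw [single_zero, add_zero, hφ] at hs
    exact hs.of_dvd (hg.mul hP).ne_zero (dvd_mul_right _ _)
  have hs : ∀ c, P - C c * Q ≠ 0 → (P - C c * Q).Splits := fun c hc => by
    have hs := hA.splits_charpoly_add_single i c
    have he : A.charpoly - C c * A.charmatrix.adjugate i i = g * (P - C c * Q) := by
      rw [hφ, hψ]; ring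
    rw [charpoly_add_single, he] at hs
    exact hs.of_dvd (mul_ne_zero hg.ne_zero hc) (dvd_mul_left _ _)
  have hd : P.natDegree = Q.natDegree + 1 := by
    have h3 := natDegree_adjugate_charmatrix A i
    have h4 := charpoly_natDegree_eq_dim A
    rw [hφ, hg.natDegree_mul hP] at h4
    rw [hψ, hg.natDegree_mul hQ] at h3
    omega
  have hlt : Q.degree < P.degree := by
    rw [degree_eq_natDegree hP.ne_zero, degree_eq_natDegree hQ.ne_zero, hd]
    exact_mod_cast Nat.lt_succ_self _
  have hc : ∀ x, Q.eval x = 0 → P.eval x ≠ 0 := fun x hx hx' => by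
    have := congrArg (eval x) hab
    simp [hx, hx'] at this
  have hsum : ∑ l, A.charmatrix.adjugate l i ^ 2
      = g ^ 2 * (derivative P * Q - P * derivative Q) := by
    rw [sum_sq_adjugate_charmatrix hA, hφ, hψ, derivative_mul, derivative_mul]
    ring
  have hle : ∀ l x, (A.charmatrix.adjugate l i).eval x ^ 2
      ≤ g.eval x ^ 2 * (derivative P * Q - P * derivative Q).eval x := fun l x => by
    have := congrArg (eval x) hsum
    simp only [eval_finsetSum, eval_mul, eval_pow] at this
    rw [← this]
    exact Finset.single_le_sum (f := fun l => (A.charmatrix.adjugate l i).eval x ^ 2)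
      (fun _ _ => sq_nonneg _) (Finset.mem_univ l)
  have hdvd : ∀ l, g ∣ A.charmatrix.adjugate l i := fun l =>
    hsg.dvd_of_sq_eval_le hg.ne_zero (hle l)
  -- Keep only the term l = i of the sum of squares and cancel g² off the finitely many roots of g;
  -- continuity gives the rest.
  have hW : ∀ x, Q.eval x ^ 2
      ≤ P.derivative.eval x * Q.eval x - P.eval x * Q.derivative.eval x := by
    intro x
    have hlim : Filter.Tendsto (fun y => (derivative P * Q - P * derivative Q - Q ^ 2).eval y)
        (nhdsWithin x ({y | g.IsRoot y})ᶜ)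
        (nhds ((derivative P * Q - P * derivative Q - Q ^ 2).eval x)) :=
      ((derivative P * Q - P * derivative Q - Q ^ 2).continuous.tendsto x).mono_left
        nhdsWithin_le_nhds
    have hbot : (nhdsWithin x ({y | g.IsRoot y})ᶜ).NeBot :=
      mem_closure_iff_nhdsWithin_neBot.1
        (((finite_setOfPred_isRoot hg.ne_zero).countable.dense_compl ℝ) x)
    have h0 : 0 ≤ (derivative P * Q - P * derivative Q - Q ^ 2).eval x := by
      refine ge_of_tendsto hlim ?_
      filter_upwards [self_mem_nhdsWithin] with y hy
      have hy' : 0 < g.eval y ^ 2 := by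
        have : g.eval y ≠ 0 := hy
        positivity
      have h3 := hle i y
      rw [hψ, eval_mul, mul_pow] at h3
      have h4 := le_of_mul_le_mul_left h3 hy'
      rw [eval_sub, eval_pow]
      linarith
    simp only [eval_mul, eval_sub, eval_pow] at h0
    linarith
  have h3 : 3 ≤ P.natDegree := by
    obtain ⟨h3, h4⟩ := natDegree_adjugate_charmatrix_of_sq_ne_zero A hj h1 h2
    have h5 := natDegree_le_of_dvd (hdvd j) h3
    have h6 := charpoly_natDegree_eq_dim A
    rw [hφ, hg.natDegree_mul hP] at h6
    omega
  obtain ⟨ε, θ, hε, hθ, hPQ⟩ : ∃ ε θ : ℝ, ε * ε = 1 ∧ (¬ ∃ k : ℤ, θ = k) ∧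
      P.eval θ = ε * Q.eval θ := by
    by_contra! h
    have := natDegree_le_two_of_integer_roots hP hQ hd hc hW
      (by simpa using hs 1 (by simpa using (hP.sub_of_left hlt).ne_zero))
      (by simpa using hs (-1) (by simpa using (hP.add_of_left hlt).ne_zero))
      (fun x hx => by
        by_contra hn
        exact h 1 x (by norm_num) (by simpa using hn) (by rw [hx, one_mul]))
      (fun x hx => by
        by_contra hn
        exact h (-1) x (by norm_num) (by simpa using hn) (by rw [hx, neg_one_mul]))
    omega
  have hQθ : Q.eval θ ≠ 0 := fun h => hc θ h (by rw [hPQ, h, mul_zero])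
  choose v hv using hdvd
  have hvi : v i = Q := mul_left_cancel₀ hg.ne_zero (by rw [← hv, hψ])
  -- The eigenvector is column i of the adjugate divided by g, evaluated at θ; dividing keeps it
  -- nonzero at i even when g(θ) = 0.
  refine ⟨ε, θ, fun l => (v l).eval θ, hε, hθ, by simpa only [hvi], ?_, fun F G hFG => ?_⟩
  · ext k
    have h4 := X_mul_adjugate_charmatrix A i k
    have h5 : X * v k = ∑ l, C (A k l) * v l + if k = i then P else 0 := by
      apply mul_left_cancel₀ hg.ne_zero
      calc g * (X * v k) = X * (g * v k) := by ring
        _ = _ := by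
          rw [← hv, h4, mul_add, Finset.mul_sum, hφ]
          congr 1
          · exact Finset.sum_congr rfl fun l _ => by rw [hv]; ring
          · split_ifs <;> simp
    have h6 := congrArg (eval θ) h5
    simp only [eval_mul, eval_X, eval_add, eval_finsetSum, eval_C] at h6
    simp only [Pi.add_apply, Pi.smul_apply, smul_eq_mul, h6, mulVec, dotProduct, hvi, ← hPQ]
    congr 1
    by_cases hk : k = i
    · subst hk; simp
    · simp [hk]
  · rw [hφ, hψ] at hFG
    have h4 : P * G = F * Q := by
      apply mul_left_cancel₀ hg.ne_zero
      linear_combination hFG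
    have h5 := congrArg (eval θ) h4
    rw [eval_mul, eval_mul, hPQ] at h5
    apply mul_right_cancel₀ hQθ
    linear_combination -h5

end Matrix

/-! ### Rooted products over the path with two vertices -/

namespace SimpleGraph

open scoped Classical in
theorem not_isIntegralGraph_of_eigenvector {V : Type*} [Fintype V] {G : SimpleGraph V} {θ : ℝ}
    (hθ : ¬ ∃ k : ℤ, θ = k) {z : V → ℝ} (hz : z ≠ 0)
    (h : ∀ x, ∑ y, (if G.Adj x y then z y else 0) = θ * z x) : ¬ G.IsIntegralGraph := by
  intro hG
  refine hθ (hG θ (Module.End.hasEigenvalue_of_hasEigenvector (x := z)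
    ⟨Module.End.mem_eigenspace_iff.2 ?_, hz⟩))
  ext x
  rw [Matrix.toLin'_apply, Pi.smul_apply, smul_eq_mul, ← h x]
  simp [Matrix.mulVec, dotProduct, adjMatrix_apply]

open scoped Classical in
theorem graphCharpoly_induce_compl {V : Type*} [Fintype V] (G : SimpleGraph V) (i : V) :
    (G.induce ({i}ᶜ : Set V)).graphCharpoly = (G.adjMatrix ℝ).charmatrix.adjugate i i := by
  rw [Matrix.adjugate_charmatrix_apply_self, graphCharpoly]
  have h := Matrix.charpoly_reindex
    (Equiv.subtypeEquivRight fun k => Set.mem_compl_singleton_iff (a := k) (b := i))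
    ((G.induce ({i}ᶜ : Set V)).adjMatrix ℝ)
  convert h.symm using 2
  · congr!
  · ext ⟨k, hk⟩ ⟨l, hl⟩
    simp [Matrix.toSquareBlockProp_def, adjMatrix_apply]

open scoped Classical in
theorem charpoly_mul_eq_of_alpha_eq {V W : Type*} [Fintype V] [Fintype W] {G : SimpleGraph V}
    {H : SimpleGraph W} {i : V} {j : W} (h : G.alpha i = H.alpha j) :
    (G.adjMatrix ℝ).charpoly * (H.adjMatrix ℝ).charmatrix.adjugate j j
      = (H.adjMatrix ℝ).charpoly * (G.adjMatrix ℝ).charmatrix.adjugate i i := by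
  rw [alpha, alpha, graphCharpoly_induce_compl, graphCharpoly_induce_compl, div_eq_div_iff,
    ← map_mul, ← map_mul] at h
  · exact RatFunc.algebraMap_injective ℝ h
  · exact RatFunc.algebraMap_ne_zero (Matrix.monic_adjugate_charmatrix _ _).ne_zero
  · exact RatFunc.algebraMap_ne_zero (Matrix.monic_adjugate_charmatrix _ _).ne_zero

theorem adjMatrix_sq_ne_zero {V : Type*} [Fintype V] {G : SimpleGraph V} [DecidableRel G.Adj]
    {u v w : V} (h1 : G.Adj u v) (h2 : G.Adj v w) :
    (G.adjMatrix ℝ * G.adjMatrix ℝ) u w ≠ 0 := by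
  rw [Matrix.mul_apply]
  refine ne_of_gt (Finset.sum_pos' (fun l _ => ?_) ⟨v, Finset.mem_univ _, ?_⟩)
  · simp only [adjMatrix_apply]
    positivity
  · simp [adjMatrix_apply, h1, h2]

theorem Connected.exists_adj_adj_of_one_lt_eccent {V : Type*} {G : SimpleGraph V}
    (hG : G.Connected) {r : V} (h : 1 < G.eccent r) :
    ∃ v w, G.Adj r v ∧ G.Adj v w ∧ ¬ G.Adj r w ∧ r ≠ w := by
  have h1 : ¬ G.eccent r ≤ 1 := not_le.2 h
  rw [eccent_le_one_iff] at h1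
  push Not at h1
  obtain ⟨w, hw, hw'⟩ := h1
  by_contra! hno
  suffices ∀ w, Relation.ReflTransGen G.Adj r w → r = w ∨ G.Adj r w from
    (this w ((reachable_iff_reflTransGen r w).1 (hG r w))).elim hw hw'
  intro w hrw
  induction hrw with
  | refl => exact Or.inl rfl
  | @tail v w _ hvw ih =>
    rcases ih with rfl | hv
    · exact Or.inr hvw
    · by_contra! h
      exact h.1 (hno v w hv hvw h.2)

theorem rootedProduct_adj_same {ι : Type*} {V : ι → Type*} {H : SimpleGraph ι}
    {G : ∀ i, SimpleGraph (V i)} {r : ∀ i, V i} {i : ι} {x y : V i} :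
    (H.rootedProduct G r).Adj ⟨i, x⟩ ⟨i, y⟩ ↔ (G i).Adj x y := by
  constructor
  · rintro (⟨i', u, v, h, ha, hb⟩ | ⟨i', j', h, ha, hb⟩)
    · obtain rfl := (Sigma.mk.inj ha).1
      obtain rfl := eq_of_heq (Sigma.mk.inj ha).2
      obtain rfl := eq_of_heq (Sigma.mk.inj hb).2
      exact h
    · exact absurd ((Sigma.mk.inj ha).1.symm.trans (Sigma.mk.inj hb).1) h.ne
  · exact fun h => Or.inl ⟨i, x, y, h, rfl, rfl⟩

theorem rootedProduct_adj_of_adj {ι : Type*} {V : ι → Type*} {H : SimpleGraph ι}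
    {G : ∀ i, SimpleGraph (V i)} {r : ∀ i, V i} {i j : ι} (hij : H.Adj i j) {x : V i} {y : V j} :
    (H.rootedProduct G r).Adj ⟨i, x⟩ ⟨j, y⟩ ↔ x = r i ∧ y = r j := by
  constructor
  · rintro (⟨i', u, v, h, ha, hb⟩ | ⟨i', j', h, ha, hb⟩)
    · exact absurd ((Sigma.mk.inj ha).1.trans (Sigma.mk.inj hb).1.symm) hij.ne
    · obtain rfl := (Sigma.mk.inj ha).1
      obtain rfl := (Sigma.mk.inj hb).1
      exact ⟨eq_of_heq (Sigma.mk.inj ha).2, eq_of_heq (Sigma.mk.inj hb).2⟩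
  · rintro ⟨rfl, rfl⟩
    exact Or.inr ⟨i, j, hij, rfl, rfl⟩

theorem rootedProduct_pathGraph_two_not_isIntegralGraph (V : Fin 2 → Type*) [∀ i, Fintype (V i)]
    (T : ∀ i, SimpleGraph (V i)) (r : ∀ i, V i) (hT : (T 0).Connected)
    (hα : (T 0).alpha (r 0) = (T 1).alpha (r 1)) (he : 1 < (T 0).eccent (r 0)) :
    ¬ ((pathGraph 2).rootedProduct T r).IsIntegralGraph := by
  classical
  obtain ⟨v, j, h1, h2, h3, h4⟩ := hT.exists_adj_adj_of_one_lt_eccent he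
  obtain ⟨ε, θ, w, hε, hθ, hw0, hw, hFG⟩ :=
    (isSymm_adjMatrix (α := ℝ) (T 0)).exists_eigenvector_add_single (i := r 0) (j := j) h4.symm
      (by simpa [adjMatrix_apply] using mt Adj.symm h3) (adjMatrix_sq_ne_zero h2.symm h1.symm)
  -- Only the existence of `u` is needed: it may vanish at the root, and then c = 0 and the glued
  -- vector lives on the second tree.
  obtain ⟨u, hu0, hu⟩ : ∃ u ≠ 0,
      (Matrix.scalar _ θ - ((T 1).adjMatrix ℝ + Matrix.single (r 1) (r 1) ε)).mulVec u = 0 := by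
    rw [Matrix.exists_mulVec_eq_zero_iff, ← Matrix.eval_charpoly, Matrix.charpoly_add_single,
      eval_sub, eval_mul, eval_C, hFG _ _ (charpoly_mul_eq_of_alpha_eq hα), sub_self]
  have hu' : ∀ x, ((T 1).adjMatrix ℝ).mulVec u x + (if x = r 1 then ε * u (r 1) else 0)
      = θ * u x := by
    intro x
    have := congrFun hu x
    rw [Matrix.sub_mulVec, Matrix.add_mulVec, Pi.sub_apply, Pi.add_apply, Pi.zero_apply,
      sub_eq_zero, Matrix.scalar_apply, Matrix.mulVec_diagonal] at this
    rw [this]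
    congr 1
    by_cases hx : x = r 1
    · subst hx; simp [Matrix.mulVec, dotProduct, Matrix.single_apply]
    · simp [Matrix.mulVec, dotProduct, hx, Ne.symm hx]
  -- Scaled so that each loop term equals the value at the other root; this uses ε² = 1.
  set c := ε * u (r 1) / w (r 0) with hc
  have hcw : c * w (r 0) = ε * u (r 1) := div_mul_cancel₀ _ hw0
  have hw' : ∀ x, ((T 0).adjMatrix ℝ).mulVec (c • w) x + (if x = r 0 then u (r 1) else 0)
      = θ * (c • w) x := by
    intro x
    have := congrArg (c * ·) (congrFun hw x)
    rw [Matrix.mulVec_smul, Pi.smul_apply, Pi.smul_apply, smul_eq_mul, smul_eq_mul]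
    simp only [Pi.add_apply, Pi.smul_apply, smul_eq_mul, mul_add] at this
    rw [mul_left_comm θ, ← this]
    congr 1
    by_cases hx : x = r 0
    · subst hx
      simp only [if_true, Pi.single_eq_same]
      linear_combination (-u (r 1)) * hε - ε * hcw
    · simp [hx]
  obtain ⟨z, hz0, hz1⟩ : ∃ z : ∀ i, V i → ℝ, z 0 = c • w ∧ z 1 = u :=
    ⟨fun i => match i with
      | 0 => c • w
      | 1 => u, rfl, rfl⟩
  refine not_isIntegralGraph_of_eigenvector hθ (z := fun s => z s.1 s.2) (fun h => hu0 ?_) ?_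
  · ext x
    simpa [hz1] using congrFun h ⟨1, x⟩
  have h01 : (pathGraph 2).Adj 0 1 := by simp [pathGraph_two_eq_top]
  rintro ⟨i, x⟩
  rw [Fintype.sum_sigma, Fin.sum_univ_two]
  obtain rfl | rfl : i = 0 ∨ i = 1 := by omega
  · simp only [rootedProduct_adj_same, rootedProduct_adj_of_adj h01]
    rw [hz0, hz1, ← hw' x]
    congr 1
    · simp [Matrix.mulVec, dotProduct, adjMatrix_apply]
    · by_cases hx : x = r 0 <;> simp [hx]
  · simp only [rootedProduct_adj_same, rootedProduct_adj_of_adj h01.symm]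
    rw [hz0, hz1, ← hu' x, add_comm]
    congr 1
    · simp [Matrix.mulVec, dotProduct, adjMatrix_apply]
    · by_cases hx : x = r 1
      · simp [hx, ← hcw]
      · simp [hx]

end SimpleGraph

/-! ### Balanced trees of odd diameter -/

namespace SimpleGraph

/-- Eigenvectors of weighted paths with a loop of weight `ε = ±1` at the first vertex. -/
theorem exists_eigenvector_path {h : ℕ} (hh : 2 ≤ h) {c : ℕ → ℝ} (hc : ∀ k < h, 0 < c k)
    (hch : c h = 0) : ∃ (ε θ : ℝ) (ζ : ℕ → ℝ), ε * ε = 1 ∧ (¬ ∃ k : ℤ, θ = k) ∧ ζ 0 ≠ 0 ∧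
      (∀ k, h < k → ζ k = 0) ∧ θ * ζ 0 = ε * ζ 0 + c 0 * ζ 1 ∧
      ∀ k < h, θ * ζ (k + 1) = ζ k + c (k + 1) * ζ (k + 2) := by
  set s : ℕ → ℝ := fun k => √(c k) with hs
  have hs0 : ∀ k < h, s k ≠ 0 := fun k hk => (Real.sqrt_pos.2 (hc k hk)).ne'
  have hss : ∀ k ≤ h, s k * s k = c k := fun k hk => by
    rcases hk.lt_or_eq with hk | rfl
    · exact Real.mul_self_sqrt (hc k hk).le
    · simp [hs, hch]
  set f : ℕ → ℕ → ℝ := fun p q => (if q = p + 1 then s p else 0) + if p = q + 1 then s q else 0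
    with hf
  -- The weights `c` are split as products of square roots to make the path matrix symmetric; the
  -- rescaling by `D` below undoes this.
  set J : Matrix (Fin (h + 1)) (Fin (h + 1)) ℝ := Matrix.of fun p q => f p q with hJ
  have hsymm : J.IsSymm := by
    ext p q
    simp [hJ, hf, add_comm]
  have hlt1 : 1 < h + 1 := by omega
  have hlt2 : 2 < h + 1 := by omega
  obtain ⟨ε, θ, w, hε, hθ, hw0, hw, -⟩ := hsymm.exists_eigenvector_add_single
    (i := ⟨0, by omega⟩) (j := ⟨2, hlt2⟩) (by simp) (by simp [hJ, hf]) (by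
      rw [Matrix.mul_apply, Finset.sum_eq_single ⟨1, hlt1⟩]
      · simpa [hJ, hf] using ⟨hs0 1 (by omega), hs0 0 (by omega)⟩
      · intro q _ hq
        have hq' : (q : ℕ) ≠ 1 := fun h => hq (Fin.ext h)
        simp only [hJ, hf, Matrix.of_apply]
        by_cases h2 : (2 : ℕ) = q + 1
        · omega
        · by_cases h3 : (q : ℕ) = 2 + 1
          · simp [h3]
          · simp [h2, h3]
      · simp)
  set y : ℕ → ℝ := fun k => if hk : k < h + 1 then w ⟨k, hk⟩ else 0 with hy
  have hyw : ∀ q : Fin (h + 1), w q = y q := fun q => by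
    simp only [hy]
    rw [dif_pos q.2]
  have hyh : ∀ k, h < k → y k = 0 := fun k hk => dif_neg (by omega)
  have hrow : ∀ p : Fin (h + 1), (∑ q ∈ Finset.range (h + 1), f p q * y q)
      + (if (p : ℕ) = 0 then ε * y 0 else 0) = θ * y p := by
    intro p
    have h1 := congrFun hw p
    rw [Pi.smul_apply, smul_eq_mul, hyw p] at h1
    rw [← h1, Pi.add_apply, ← Fin.sum_univ_eq_sum_range (fun q => f p q * y q)]
    congr 1
    · exact Finset.sum_congr rfl fun q _ => by rw [hyw q]; rfl
    · rw [hyw, Pi.single_apply]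
      simp only [Fin.ext_iff]
  have hsum1 : ∀ p ≤ h, ∑ q ∈ Finset.range (h + 1), (if q = p + 1 then s p else 0) * y q
      = s p * y (p + 1) := by
    intro p hp
    simp only [ite_mul, zero_mul, Finset.sum_ite_eq', Finset.mem_range]
    split_ifs with h1
    · rfl
    · rw [hyh _ (by omega), mul_zero]
  have h0 : θ * y 0 = ε * y 0 + s 0 * y 1 := by
    have := hrow ⟨0, by omega⟩
    simp only [hf, add_mul, Finset.sum_add_distrib, hsum1 0 (by omega)] at this
    simp only [if_true, (Nat.succ_ne_zero _).symm, if_false, zero_mul, Finset.sum_const_zero]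
      at this
    linarith
  have hsucc : ∀ k < h, θ * y (k + 1) = s k * y k + s (k + 1) * y (k + 2) := by
    intro k hk
    have := hrow ⟨k + 1, by omega⟩
    simp only [hf, add_mul, Finset.sum_add_distrib, hsum1 (k + 1) (by omega)] at this
    simp only [Nat.add_right_cancel_iff, Nat.succ_ne_zero, if_false, ite_mul, zero_mul,
      Finset.sum_ite_eq, Finset.mem_range, show k < h + 1 by omega, if_true] at this
    linarith
  set D : ℕ → ℝ := fun k => ∏ i ∈ Finset.range k, s i with hD
  have hD0 : ∀ k ≤ h, D k ≠ 0 := fun k hk =>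
    Finset.prod_ne_zero_iff.2 fun i hi => hs0 i (by have := Finset.mem_range.1 hi; omega)
  have hDs : ∀ k, D (k + 1) = D k * s k := fun k => Finset.prod_range_succ _ _
  have hcy : ∀ k ≤ h, c k * (y (k + 1) / D (k + 1)) = s k * y (k + 1) / D k := by
    intro k hk
    rcases hk.lt_or_eq with hk' | rfl
    · rw [hDs, ← hss k hk]
      have := hs0 k hk'
      have := hD0 k hk
      field_simp
    · rw [hyh _ (Nat.lt_succ_self _)]
      simp
  refine ⟨ε, θ, fun k => y k / D k, hε, hθ, ?_, fun k hk => by simp [hyh k hk], ?_, ?_⟩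
  · simpa [hD, ← hyw ⟨0, by omega⟩, hy] using hw0
  · rw [hcy 0 (by omega), ← mul_div_assoc, h0, add_div, mul_div_assoc]
  · intro k hk
    simp only []
    rw [hcy (k + 1) hk, ← mul_div_assoc, hsucc k hk, add_div]
    congr 1
    rw [hDs]
    have := hs0 k hk
    have := hD0 k hk.le
    field_simp

variable {W : Type*} {T : SimpleGraph W}

/-- Two neighbours nearer to `a` would give two different paths from `a` to `x`. -/
theorem IsTree.existsUnique_adj_dist (hT : T.IsTree) {a x : W} (hx : T.dist a x ≠ 0) :
    ∃ p, T.Adj x p ∧ T.dist a x = T.dist a p + 1 ∧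
      ∀ y, T.Adj x y → T.dist a x = T.dist a y + 1 → y = p := by
  have huniq : ∀ y y', T.Adj x y → T.dist a x = T.dist a y + 1 → T.Adj x y' →
      T.dist a x = T.dist a y' + 1 → y = y' := by
    have hpath : ∀ y (h : T.Adj x y), T.dist a x = T.dist a y + 1 →
        ∃ q : T.Walk a x, q.IsPath ∧ q.penultimate = y := by
      intro y h hd
      obtain ⟨q, hq⟩ := hT.connected.exists_walk_length_eq_dist a y
      exact ⟨q.concat h.symm, Walk.isPath_of_length_eq_dist _ (by rw [Walk.length_concat, hq, hd]),
        Walk.penultimate_concat _ _⟩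
    intro y y' h1 h2 h1' h2'
    obtain ⟨q, hq, rfl⟩ := hpath y h1 h2
    obtain ⟨q', hq', rfl⟩ := hpath y' h1' h2'
    rw [(hT.existsUnique_path a x).unique hq hq']
  obtain ⟨q, hq⟩ := hT.connected.exists_walk_length_eq_dist a x
  have hnil : ¬ q.Nil := by
    rw [← Walk.length_eq_zero_iff]
    omega
  have hadj := q.adj_penultimate hnil
  have hlt : T.dist a q.penultimate + 1 ≤ T.dist a x := by
    have h1 := dist_le q.dropLast
    have h2 := congrArg Walk.length (q.concat_dropLast hadj)
    rw [Walk.length_concat] at h2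
    omega
  have hp : T.dist a x = T.dist a q.penultimate + 1 := by
    rcases hT.dist_eq_dist_add_one_of_adj a hadj with h | h <;> omega
  exact ⟨_, hadj.symm, hp, fun y h1 h2 => huniq _ _ h1 h2 hadj.symm hp⟩

/-- In a tree with an edge `{a, b}`, a vertex on the side of `a` has one neighbour nearer to the
edge (or it is `a`, and the neighbour is `b`); the others are further away, on the same side. -/
theorem IsTree.exists_parent (hT : T.IsTree) {a b : W} (hab : T.Adj a b) {x : W} {k : ℕ}
    (hxa : T.dist a x = k) (hxb : T.dist b x = k + 1) :
    ∃ p, T.Adj x p ∧ (k = 0 ∧ p = b ∨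
        ∃ l, k = l + 1 ∧ T.dist a p = l ∧ T.dist b p = l + 1) ∧
      ∀ y, T.Adj x y → y ≠ p → T.dist a y = k + 1 ∧ T.dist b y = k + 2 := by
  obtain ⟨p, hp, hpd, hpu⟩ := hT.existsUnique_adj_dist (a := b) (x := x) (by omega)
  have hside : ∀ y, T.dist a y = T.dist b y + 1 ∨ T.dist b y = T.dist a y + 1 := fun y => by
    have := hT.dist_eq_dist_add_one_of_adj y hab
    rwa [dist_comm (u := y), dist_comm (u := y)] at this
  refine ⟨p, hp, ?_, fun y hy hyp => ?_⟩
  · rcases Nat.eq_zero_or_pos k with rfl | hk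
    · refine Or.inl ⟨rfl, ?_⟩
      exact ((hT.connected.dist_eq_zero_iff).1 (by omega)).symm
    · obtain ⟨l, rfl⟩ : ∃ l, k = l + 1 := ⟨k - 1, by omega⟩
      refine Or.inr ⟨l, rfl, ?_⟩
      obtain ⟨q, hq, hqd, hqu⟩ := hT.existsUnique_adj_dist (a := a) (x := x) (by omega)
      have h1 := hT.dist_eq_dist_add_one_of_adj b hq
      have h2 := hside q
      obtain rfl := hpu q hq (by omega)
      omega
  · have h1 := hT.dist_eq_dist_add_one_of_adj b hy
    have h2 := hT.dist_eq_dist_add_one_of_adj a hy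
    have h3 : ¬ T.dist b x = T.dist b y + 1 := fun h => hyp (hpu y hy h)
    have h4 := hside y
    omega

theorem IsTree.sum_adj (hT : T.IsTree) [Fintype W] [DecidableRel T.Adj] {a b : W}
    (hab : T.Adj a b) {x : W} {k : ℕ}
    (hxa : T.dist a x = k) (hxb : T.dist b x = k + 1) {F : W → ℝ} {α β : ℝ}
    (hα : ∀ y, T.dist a y = k + 1 → T.dist b y = k + 2 → F y = α)
    (hβ : ∀ l, k = l + 1 → ∀ y, T.dist a y = l → T.dist b y = l + 1 → F y = β)
    (hβ' : k = 0 → F b = β) :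
    ∑ y, (if T.Adj x y then F y else 0) = β + (T.degree x - 1) * α := by
  classical
  obtain ⟨p, hp, hp1, hp2⟩ := hT.exists_parent hab hxa hxb
  have hpF : F p = β := by
    rcases hp1 with ⟨hk, rfl⟩ | ⟨l, hk, h1, h2⟩
    · exact hβ' hk
    · exact hβ l hk p h1 h2
  have hmem : p ∈ T.neighborFinset x := by simpa using hp
  rw [← Finset.sum_filter, ← neighborFinset_eq_filter, ← Finset.add_sum_erase _ _ hmem, hpF,
    Finset.sum_congr rfl fun y hy => ?_, Finset.sum_const, Finset.card_erase_of_mem hmem,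
    card_neighborFinset_eq_degree, nsmul_eq_mul, Nat.cast_sub, Nat.cast_one]
  · exact (T.degree_pos_iff_exists_adj x).2 ⟨p, hp⟩
  · rw [Finset.mem_erase, mem_neighborFinset] at hy
    obtain ⟨h1, h2⟩ := hp2 y hy.2 hy.1
    exact hα y h1 h2

/-- The eigenvalue equation on the side of `a`, where the value at `b` acts as the loop. A general
`F` allows reuse on the other side with the ends swapped and the vector multiplied by ε. -/
theorem IsTree.sum_adj_eq_of_degree_eq (hT : T.IsTree) [Fintype W] [DecidableRel T.Adj] {a b : W}
    (hab : T.Adj a b) {h : ℕ} (hh : 0 < h) {c : ℕ → ℝ} (hch : c h = 0) {ε θ : ℝ} {ζ : ℕ → ℝ}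
    (hζ : ∀ k, h < k → ζ k = 0) (hζ0 : θ * ζ 0 = ε * ζ 0 + c 0 * ζ 1)
    (hζs : ∀ k < h, θ * ζ (k + 1) = ζ k + c (k + 1) * ζ (k + 2))
    (hdeg : ∀ x, T.dist a x ≤ h → T.dist b x = T.dist a x + 1 →
      (T.degree x : ℝ) = c (T.dist a x) + 1)
    {F : W → ℝ} (hF : ∀ y, T.dist b y = T.dist a y + 1 → F y = ζ (T.dist a y))
    (hFb : F b = ε * ζ 0) {x : W} (hx : T.dist b x = T.dist a x + 1) :
    ∑ y, (if T.Adj x y then F y else 0) = θ * ζ (T.dist a x) := by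
  classical
  obtain ⟨k, hk⟩ : ∃ k, T.dist a x = k := ⟨_, rfl⟩
  rw [hk] at hx
  have hα : ∀ y, T.dist a y = k + 1 → T.dist b y = k + 2 → F y = ζ (k + 1) := fun y h1 h2 => by
    rw [hF y (by omega), h1]
  rcases Nat.eq_zero_or_pos k with rfl | hk0
  · rw [hT.sum_adj hab hk hx hα (fun l hl => by omega) fun _ => hFb, hdeg x (by omega) (by omega),
      hk, hζ0]
    ring
  obtain ⟨l, rfl⟩ : ∃ l, k = l + 1 := ⟨k - 1, by omega⟩
  rw [hT.sum_adj hab hk hx hα (β := ζ l) (fun l' hl y h1 h2 => by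
    rw [hF y (by omega), h1]; congr 1; omega) (fun h => by omega), hk]
  rcases lt_trichotomy l h with hl | rfl | hl
  · rw [hdeg x (by omega) (by omega), hζs l hl, hk]
    ring
  -- Level h + 1 is empty: the parent of `x` would be a leaf, yet it is adjacent both to `x` and to
  -- its own parent.
  · exfalso
    obtain ⟨p, hp, hp1, -⟩ := hT.exists_parent hab hk hx
    obtain ⟨-, hpa, hpb⟩ : l + 1 = l + 1 ∧ T.dist a p = l ∧ T.dist b p = l + 1 := by
      rcases hp1 with ⟨h0, -⟩ | ⟨l', h0, h1, h2⟩ <;> omega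
    have hdp := hdeg p hpa.le (by omega)
    rw [hpa, hch, zero_add] at hdp
    obtain ⟨q, hq, hq1, -⟩ := hT.exists_parent hab hpa hpb
    have hdp' : T.degree p = 1 := by exact_mod_cast hdp
    obtain ⟨r, -, hr⟩ := degree_eq_one_iff_existsUnique_adj.1 hdp'
    have hqx : q = x := (hr q hq).trans (hr x hp.symm).symm
    rcases hq1 with ⟨h0, -⟩ | ⟨l', h0, h1, -⟩
    · omega
    · rw [hqx] at h1
      omega
  · rw [hζ l hl, hζ _ (by omega), hζ (l + 1) (by omega)]
    ring

theorem IsTree.not_isIntegralGraph_of_degree_eq (hT : T.IsTree) [Fintype W] [DecidableRel T.Adj]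
    {a b : W} (hab : T.Adj a b) {h : ℕ} (hh : 2 ≤ h) {c : ℕ → ℝ} (hc : ∀ k < h, 0 < c k)
    (hch : c h = 0)
    (hdega : ∀ x, T.dist a x ≤ h → T.dist b x = T.dist a x + 1 →
      (T.degree x : ℝ) = c (T.dist a x) + 1)
    (hdegb : ∀ x, T.dist b x ≤ h → T.dist a x = T.dist b x + 1 →
      (T.degree x : ℝ) = c (T.dist b x) + 1) : ¬ T.IsIntegralGraph := by
  obtain ⟨ε, θ, ζ, hε, hθ, hz0, hζ, hζ0, hζs⟩ := exists_eigenvector_path hh hc hch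
  set z : W → ℝ := fun x =>
    if T.dist b x = T.dist a x + 1 then ζ (T.dist a x) else ε * ζ (T.dist b x) with hz
  have hba : T.dist b a = 1 := dist_eq_one_iff_adj.2 hab.symm
  have hab1 : T.dist a b = 1 := dist_eq_one_iff_adj.2 hab
  have hside : ∀ y, T.dist a y = T.dist b y + 1 ∨ T.dist b y = T.dist a y + 1 := fun y => by
    have := hT.dist_eq_dist_add_one_of_adj y hab
    rwa [dist_comm (u := y), dist_comm (u := y)] at this
  have hza : ∀ y, T.dist b y = T.dist a y + 1 → z y = ζ (T.dist a y) := fun y hy => if_pos hy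
  have hzb : ∀ y, T.dist a y = T.dist b y + 1 → z y = ε * ζ (T.dist b y) := fun y hy =>
    if_neg (by omega)
  have ha : z a = ζ 0 := by rw [hza a (by simp [hba]), dist_self]
  have hb : z b = ε * ζ 0 := by rw [hzb b (by simp [hab1]), dist_self]
  refine not_isIntegralGraph_of_eigenvector hθ (z := z) (fun h0 => hz0 ?_) fun x => ?_
  · rw [← ha, h0, Pi.zero_apply]
  rcases hside x with hx | hx
  · have := hT.sum_adj_eq_of_degree_eq hab.symm (by omega) hch hζ hζ0 hζs hdegb
      (F := fun y => ε * z y) (fun y hy => by rw [hzb y hy, ← mul_assoc, hε, one_mul])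
      (by rw [ha]) hx
    rw [hzb x hx, mul_left_comm, ← this, Finset.mul_sum]
    refine Finset.sum_congr rfl fun y _ => ?_
    split_ifs
    · rw [← mul_assoc, hε, one_mul]
    · rw [mul_zero]
  · rw [hza x hx, ← hT.sum_adj_eq_of_degree_eq hab (by omega) hch hζ hζ0 hζs hdega hza hb hx]
    refine Finset.sum_congr rfl fun y _ => ?_
    congr

theorem Walk.dist_getVert_of_length_eq_dist (hT : T.Connected) {u v : W} {p : T.Walk u v}
    (hp : p.length = T.dist u v) {i j : ℕ} (hij : i ≤ j) (hj : j ≤ p.length) :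
    T.dist (p.getVert i) (p.getVert j) = j - i := by
  have hle : ∀ i j, i ≤ j → j ≤ p.length → T.dist (p.getVert i) (p.getVert j) ≤ j - i := by
    intro i j hij
    induction j, hij using Nat.le_induction with
    | base => simp
    | succ j hij ih =>
      intro hj
      have h1 := ih (by omega)
      have h2 := dist_eq_one_iff_adj.2 (p.adj_getVert_succ (i := j) (by omega))
      have h3 := hT.dist_triangle (u := p.getVert i) (v := p.getVert j) (w := p.getVert (j + 1))
      omega
  have h1 := hle 0 i (by omega) (by omega)
  have h2 := hle i j hij hj
  have h3 := hle j p.length hj le_rfl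
  rw [p.getVert_zero] at h1
  rw [p.getVert_length] at h3
  have h4 := hT.dist_triangle (u := u) (v := p.getVert i) (w := v)
  have h5 := hT.dist_triangle (u := p.getVert i) (v := p.getVert j) (w := v)
  omega

theorem IsBalancedTree.not_isIntegralGraph [Fintype W] (hT : T.IsBalancedTree)
    (hodd : Odd T.diam) (hd : 3 < T.diam) : ¬ T.IsIntegralGraph := by
  classical
  obtain ⟨hT, u, v, p, ⟨hp, hdiam⟩, hbal⟩ := hT
  obtain ⟨h, hh⟩ := hodd
  have hlen : p.length = 2 * h + 1 := by omega
  have hdist : ∀ i j, i ≤ j → j ≤ 2 * h + 1 → T.dist (p.getVert i) (p.getVert j) = j - i :=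
    fun i j hij hj => Walk.dist_getVert_of_length_eq_dist hT.connected hp hij (hlen ▸ hj)
  set a := p.getVert h with ha
  set b := p.getVert (h + 1) with hb
  have hab : T.Adj a b := p.adj_getVert_succ (by omega)
  have hmid : ∀ x, p.distToMiddle x = min (T.dist a x) (T.dist b x) := fun x => by
    rw [Walk.distToMiddle, hlen, show (2 * h + 1) / 2 = h by omega,
      show (2 * h + 1 + 1) / 2 = h + 1 by omega, dist_comm (u := x), dist_comm (u := x)]
  have hxa : ∀ k ≤ h, T.dist a (p.getVert (h - k)) = k := fun k hk => by
    rw [dist_comm, hdist _ _ (by omega) (by omega)]; omega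
  have hxb : ∀ k ≤ h, T.dist b (p.getVert (h - k)) = k + 1 := fun k hk => by
    rw [dist_comm, hdist _ _ (by omega) (by omega)]; omega
  have hdeg : ∀ x k, k ≤ h → min (T.dist a x) (T.dist b x) = k →
      T.degree x = T.degree (p.getVert (h - k)) := fun x k hk hx => by
    convert hbal x (p.getVert (h - k)) (by rw [hmid, hmid, hx, hxa k hk, hxb k hk]; omega)
  refine hT.not_isIntegralGraph_of_degree_eq hab (h := h) (by omega)
    -- The number of children at level k, read off the half of the diametral path from `a` back to
    -- `u`. It is positive for k < h, and zero at `u`, since an end of a diametral path is a leaf.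
    (c := fun k => T.degree (p.getVert (h - k)) - 1) (fun k hk => ?_) ?_ ?_ ?_
  · obtain ⟨q, hq, hq1, -⟩ := hT.exists_parent hab (hxa k hk.le) (hxb k hk.le)
    have hadj : T.Adj (p.getVert (h - k)) (p.getVert (h - (k + 1))) := by
      have := p.adj_getVert_succ (i := h - (k + 1)) (by omega)
      rw [show h - (k + 1) + 1 = h - k by omega] at this
      exact this.symm
    have hne : q ≠ p.getVert (h - (k + 1)) := by
      rintro rfl
      have h1 := hxa (k + 1) (by omega)
      have h2 := hxb (k + 1) (by omega)
      rcases hq1 with ⟨-, h3⟩ | ⟨l, h3, h4, -⟩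
      · rw [h3, dist_self] at h2
        omega
      · omega
    have : 1 < T.degree (p.getVert (h - k)) := by
      rw [← card_neighborFinset_eq_degree, Finset.one_lt_card]
      exact ⟨q, by simpa using hq, _, by simpa using hadj, hne⟩
    have : (1 : ℝ) < T.degree (p.getVert (h - k)) := by exact_mod_cast this
    linarith
  · have huv : T.dist v u = 2 * h + 1 := by rw [dist_comm]; omega
    obtain ⟨q, hq, -, hqu⟩ := hT.existsUnique_adj_dist (a := v) (x := u) (by omega)
    have : T.degree u = 1 := degree_eq_one_iff_existsUnique_adj.2 ⟨q, hq, fun y hy => hqu y hy (by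
      have h1 := hT.dist_eq_dist_add_one_of_adj v hy
      have h2 := dist_le_diam (ediam_ne_top_of_diam_ne_zero (G := T) (by omega)) (u := v) (v := y)
      omega)⟩
    change (T.degree (p.getVert (h - h)) : ℝ) - 1 = 0
    rw [Nat.sub_self, p.getVert_zero, this, Nat.cast_one, sub_self]
  · intro x hx hx'
    rw [hdeg x (T.dist a x) hx (by omega)]
    ring
  · intro x hx hx'
    rw [hdeg x (T.dist b x) hx (by omega)]
    ring

end SimpleGraph

theorem mainTheorem3 :
    (∀ (V : Fin 2 → Type*) [∀ i, Fintype (V i)]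
      (T : ∀ i, SimpleGraph (V i)) (r : ∀ i, V i),
      (∀ i, (T i).IsTree) →
      (T 0).alpha (r 0) = (T 1).alpha (r 1) →
      1 < (T 0).eccent (r 0) →
      ¬ ((SimpleGraph.pathGraph 2).rootedProduct T r).IsIntegralGraph) ∧
    (∀ (W : Type*) [Fintype W] (T : SimpleGraph W),
      T.IsBalancedTree → Odd T.diam → 3 < T.diam → ¬ T.IsIntegralGraph) :=
  ⟨fun V _ T r hT hα he => SimpleGraph.rootedProduct_pathGraph_two_not_isIntegralGraph V T r
    (hT 0).connected hα he, fun _ _ _ hT hodd hd => hT.not_isIntegralGraph hodd hd⟩
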